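/- **Conventions.** A prederivator is a strict 2-functor $\mathbb D:\mathrm{Cat}^{\mathrm{op}}\to\mathrm{CAT}$ from small categories to categories, reversing functors ($u:I\to J$ gives $u^*:\mathbb D(J)\to\mathbb D(I)$) and preserving the direction of natural transformations. It is a derivator if: (Der1) $\mathbb D(\coprod_i I_i)\to\prod_i\mathbb D(I_i)$ is an equivalence for every small family $(I_i)$ of small categories; (Der2) a morphism $f$ of $\mathbb D(J)$ is invertible as soon as $j^*f$ is invertible in $\mathbb D(e)$ for every object $j:e\to J$, where $e$ is the terminal category; (Der3) every $u^*$ has a left adjoint $u_!$ and a right adjoint $u_*$; (Der4) for $u:J\to K$ and $k\in K$, the base change morphisms $\pi_!\,p^*\to k^*u_!$ (for $p:u/k\to J$, $\pi:u/k\to e$) and $k^*u_*\to\pi_*\,p^*$ (for $p:k/u\to J$, $\pi:k/u\to e$) are invertible. A strict morphism of prederivators is a strict 2-natural transformation; an isomorphism is an invertible strict morphism. For a small category $L$, $\mathbb D^L$ is the prederivator $I\mapsto\mathbb D(L\times I)$. A strict morphism $\varphi:\mathbb D\to\mathbb D'$ is a strong equivalence if there is a strict morphism $\psi:\mathbb D'\to\mathbb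 D$ such that $\psi\varphi$ and $\varphi\psi$ are connected to the identities by finite zigzags of elementary homotopies, an elementary homotopy between $\varphi_0,\varphi_1:\mathbb D\to\mathbb D'$ being a strict morphism $H:\mathbb D\to\mathbb D'^{[1]}$ that restricts to $\varphi_0$ and $\varphi_1$ at the two objects of $[1]=\{0\to1\}$ and whose values have invertible underlying morphism $0^*H(X)\to1^*H(X)$. Let $\mathcal M$ be a (locally small) category with a class $\mathcal W$ of morphisms. For a small category $I$ let $\mathcal W^I$ be the class of morphisms of $\mathcal M^I$ that are objectwise in $\mathcal W$, and let $\mathrm{HO}(\mathcal M,\mathcal W)$ be the prederivator $I\mapsto\mathcal M^I[(\mathcal W^I)^{-1}]$. The pair $(\mathcal M,\mathcal W)$ *induces a derivator* if all the localizations $\mathcal M^I[(\mathcal W^I)^{-1}]$ have small hom-sets and $\mathrm{HO}(\mathcal M,\mathcal W)$ is a derivator. **Proposition.** Suppose that $(\mathcal M,\mathcal W)$ induces a derivator $\mathbb D=\mathrm{HO}(\mathcal M,\mathcal W)$, and let $L$ be a small category. Then $(\mathcal M^L,\mathcal W^L)$ induces a derivator, $\mathbb D^L$ is a derivator, and there is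 an isomorphism of derivators $\varphi:\mathrm{HO}(\mathcal M^L,\mathcal W^L)\to\mathbb D^L$, which is moreover a strong equivalence. This isomorphism is the canonical one: for every small category $I$, the functor $\varphi_I$ composed with the localization functor $(\mathcal M^L)^I\to\mathrm{HO}(\mathcal M^L,\mathcal W^L)(I)$ equals the exponential law $(\mathcal M^L)^I\cong\mathcal M^{L\times I}$ followed by the localization functor $\mathcal M^{L\times I}\to\mathbb D(L\times I)$. -/

import Mathlib

open CategoryTheory

universe w v v₁ v₂ u u₁ u₂

/-- A prederivator: a strict 2-functor from small categories to categories that reverses the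
direction of functors and keeps the direction of natural transformations. The category attached
to `I` is `D.obj I`, the functor attached to `F : I ⥤ J` is `D.map F : D.obj J ⥤ D.obj I`, and the
natural transformation attached to `α : F ⟶ G` is `D.map₂ α : D.map F ⟶ D.map G`. -/
structure Prederivator : Type (max (w + 1) (v + 1) (u + 1)) where
  obj (I : Type w) [SmallCategory I] : Type u
  cat (I : Type w) [SmallCategory I] : Category.{v} (obj I)
  map {I J : Type w} [SmallCategory I] [SmallCategory J] (F : I ⥤ J) : obj J ⥤ obj I
  map₂ {I J : Type w} [SmallCategory I] [SmallCategory J] {F G : I ⥤ J} (α : F ⟶ G) :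
    map F ⟶ map G
  map_id (I : Type w) [SmallCategory I] : map (𝟭 I) = 𝟭 (obj I)
  map_comp {I J K : Type w} [SmallCategory I] [SmallCategory J] [SmallCategory K]
    (F : I ⥤ J) (G : J ⥤ K) : map (F ⋙ G) = map G ⋙ map F
  map₂_id {I J : Type w} [SmallCategory I] [SmallCategory J] (F : I ⥤ J) :
    map₂ (𝟙 F) = 𝟙 (map F)
  map₂_comp {I J : Type w} [SmallCategory I] [SmallCategory J] {F G H : I ⥤ J}
    (α : F ⟶ G) (β : G ⟶ H) : map₂ (α ≫ β) = map₂ α ≫ map₂ β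
  map₂_whiskerLeft {I J K : Type w} [SmallCategory I] [SmallCategory J] [SmallCategory K]
    (F : I ⥤ J) {G H : J ⥤ K} (α : G ⟶ H) :
    map₂ (Functor.whiskerLeft F α) =
      eqToHom (map_comp F G) ≫ Functor.whiskerRight (map₂ α) (map F) ≫
        eqToHom (map_comp F H).symm
  map₂_whiskerRight {I J K : Type w} [SmallCategory I] [SmallCategory J] [SmallCategory K]
    {F G : I ⥤ J} (α : F ⟶ G) (H : J ⥤ K) :
    map₂ (Functor.whiskerRight α H) =
      eqToHom (map_comp F H) ≫ Functor.whiskerLeft (map H) (map₂ α) ≫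
        eqToHom (map_comp G H).symm

namespace Prederivator

attribute [instance] Prederivator.cat

/-- The one-object category `e` with only its identity morphism. -/
abbrev Pt : Type w := Discrete PUnit.{w + 1}

/-- The functor `e ⥤ K` selecting the object `k`. -/
abbrev pt {K : Type w} [SmallCategory K] (k : K) : Pt.{w} ⥤ K := Functor.fromPUnit k

/-- A strict morphism of prederivators: a strict 2-natural transformation. -/
@[ext]
structure StrictHom (D D' : Prederivator.{w, v, u}) where
  app (I : Type w) [SmallCategory I] : D.obj I ⥤ D'.obj I
  naturality {I J : Type w} [SmallCategory I] [SmallCategory J] (F : I ⥤ J) :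
    D.map F ⋙ app I = app J ⋙ D'.map F
  naturality₂ {I J : Type w} [SmallCategory I] [SmallCategory J] {F G : I ⥤ J} (α : F ⟶ G) :
    Functor.whiskerRight (D.map₂ α) (app I) =
      eqToHom (naturality F) ≫ Functor.whiskerLeft (app J) (D'.map₂ α) ≫
        eqToHom (naturality G).symm

/-- Prederivators and strict morphisms form a category; its isomorphisms are the strict
isomorphisms of prederivators. -/
instance : Category Prederivator.{w, v, u} where
  Hom := StrictHom
  id D :=
    { app := fun I => 𝟭 (D.obj I)
      naturality := fun _ => rfl
      naturality₂ := fun α => by ext; simp }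
  comp {D D' D''} φ ψ :=
    { app := fun I => φ.app I ⋙ ψ.app I
      naturality := fun {I J} _ _ F => by
        rw [← Functor.assoc, φ.naturality, Functor.assoc, ψ.naturality, Functor.assoc]
      naturality₂ := fun {I J} _ _ F G α => by
        ext X
        have h₁ := congrArg (fun t => (ψ.app I).map t) (NatTrans.congr_app (φ.naturality₂ α) X)
        have h₂ := NatTrans.congr_app (ψ.naturality₂ α) ((φ.app J).obj X)
        simp only [Functor.whiskerRight_app, Functor.whiskerLeft_app, NatTrans.comp_app,
          eqToHom_app, Functor.map_comp, eqToHom_map, Functor.comp_map] at h₁ h₂ ⊢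
        rw [h₁, h₂]
        simp }

variable (D : Prederivator.{w, v, u})

/-- The 2-cell `F^* ⋙ P^* ⟶ G^* ⋙ Q^*` obtained from a 2-cell `P ⋙ F ⟶ Q ⋙ G`. -/
def square {A I J K : Type w} [SmallCategory A] [SmallCategory I] [SmallCategory J]
    [SmallCategory K] {P : A ⥤ I} {F : I ⥤ K} {Q : A ⥤ J} {G : J ⥤ K} (α : P ⋙ F ⟶ Q ⋙ G) :
    TwoSquare (D.map F) (D.map G) (D.map P) (D.map Q) :=
  TwoSquare.mk _ _ _ _ (eqToHom (D.map_comp P F).symm ≫ D.map₂ α ≫ eqToHom (D.map_comp Q G))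

/-- The axioms of a derivator. -/
structure IsDerivator : Prop where
  /-- Coproducts of small categories are sent to products, up to equivalence. -/
  der₁ {ι : Type w} (I : ι → Type w) [∀ i, SmallCategory (I i)] :
    (Functor.pi' fun i => D.map (Sigma.incl (C := I) i)).IsEquivalence
  /-- Isomorphisms are detected on objects of the shape. -/
  der₂ {J : Type w} [SmallCategory J] {X Y : D.obj J} (f : X ⟶ Y)
    (h : ∀ j : J, IsIso ((D.map (pt j)).map f)) : IsIso f
  /-- Homotopy left Kan extensions exist. -/
  der₃_left {J K : Type w} [SmallCategory J] [SmallCategory K] (F : J ⥤ K) :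
    (D.map F).IsRightAdjoint
  /-- Homotopy right Kan extensions exist. -/
  der₃_right {J K : Type w} [SmallCategory J] [SmallCategory K] (F : J ⥤ K) :
    (D.map F).IsLeftAdjoint
  /-- Left Kan extensions are computed pointwise: with `p : F/k ⥤ J` and `π : F/k ⥤ e` the
  projections, the base change morphism `π_! p^* ⟶ k^* F_!` is invertible. -/
  der₄_left {J K : Type w} [SmallCategory J] [SmallCategory K] (F : J ⥤ K) (k : K)
    (lF : D.obj J ⥤ D.obj K) (adjF : lF ⊣ D.map F)
    (lπ : D.obj (Comma F (pt k)) ⥤ D.obj Pt.{w}) (adjπ : lπ ⊣ D.map (Comma.snd F (pt k))) :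
    IsIso ((mateEquiv adjF adjπ).symm (D.square (Comma.natTrans F (pt k)))).natTrans
  /-- Right Kan extensions are computed pointwise: with `p : k/F ⥤ J` and `π : k/F ⥤ e` the
  projections, the base change morphism `k^* F_* ⟶ π_* p^*` is invertible. -/
  der₄_right {J K : Type w} [SmallCategory J] [SmallCategory K] (F : J ⥤ K) (k : K)
    (rF : D.obj J ⥤ D.obj K) (adjF : D.map F ⊣ rF)
    (rπ : D.obj (Comma (pt k) F) ⥤ D.obj Pt.{w}) (adjπ : D.map (Comma.fst (pt k) F) ⊣ rπ) :
    IsIso (mateEquiv adjF adjπ (D.square (Comma.natTrans (pt k) F))).natTrans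

/-- The shift `D^L`, with `D^L(I) = D(L × I)`: the composite of `D` with `L × -`. -/
def shift (L : Type w) [SmallCategory L] : Prederivator.{w, v, u} where
  obj I _ := D.obj (L × I)
  cat I _ := D.cat (L × I)
  map F := D.map ((𝟭 L).prod F)
  map₂ α := D.map₂ (NatTrans.prod (𝟙 (𝟭 L)) α)
  map_id I _ := D.map_id (L × I)
  map_comp F G := by
    refine Eq.trans ?_ (D.map_comp ((𝟭 L).prod F) ((𝟭 L).prod G))
    rfl
  map₂_id F := D.map₂_id ((𝟭 L).prod F)
  map₂_comp α β := by
    rw [← D.map₂_comp]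
    congr 1
    ext X <;> simp [NatTrans.prod]
  map₂_whiskerLeft F _ _ α :=
    D.map₂_whiskerLeft ((𝟭 L).prod F) (NatTrans.prod (𝟙 (𝟭 L)) α)
  map₂_whiskerRight α H :=
    D.map₂_whiskerRight (NatTrans.prod (𝟙 (𝟭 L)) α) ((𝟭 L).prod H)

/-- The category `[1]`, with two objects and one non-identity morphism. -/
abbrev Arr : Type w := ULift.{w} (Fin 2)

/-- The inclusion `I ⥤ [1] × I` at the source (`a = 0`) or at the target (`a = 1`). -/
abbrev inclAt (a : Fin 2) (I : Type w) [SmallCategory I] : I ⥤ Arr.{w} × I :=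
  Prod.sectR (ULift.up a) I

/-- The natural transformation from the inclusion at `0` to the inclusion at `1`. -/
def inclArr (I : Type w) [SmallCategory I] : inclAt 0 I ⟶ inclAt 1 I where
  app x := Prod.mkHom (homOfLE (show (ULift.up 0 : Arr.{w}) ≤ ULift.up 1 from Fin.zero_le 1)) (𝟙 x)
  naturality x y f := by
    refine Prod.hom_ext ?_ ?_
    · exact Subsingleton.elim _ _
    · exact (Category.comp_id f).trans (Category.id_comp f).symm

variable {D} {D' : Prederivator.{w, v, u}}

/-- An elementary homotopy between strict morphisms `φ, ψ : D ⟶ D'`: a strict morphism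
`D ⟶ D'^[1]` whose values are coherent diagrams of isomorphisms, and whose restrictions to the
two ends of `[1]` are `φ` and `ψ`. -/
def ElementaryHomotopic (φ ψ : D ⟶ D') : Prop :=
  ∃ H : D ⟶ D'.shift Arr.{w},
    (∀ (I : Type w) [SmallCategory I],
      (StrictHom.app H I ⋙ D'.map (inclAt 0 I) : D.obj I ⥤ D'.obj I) = StrictHom.app φ I ∧
      (StrictHom.app H I ⋙ D'.map (inclAt 1 I) : D.obj I ⥤ D'.obj I) = StrictHom.app ψ I) ∧
    ∀ (I : Type w) [SmallCategory I] (X : D.obj I),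
      IsIso ((D'.map₂ (inclArr I)).app ((StrictHom.app H I).obj X))

/-- A strict morphism is a strong equivalence if it has a strict morphism as an inverse up to
(chains of) elementary homotopies, that is, if it is a homotopy equivalence for the simplicial
enrichment of prederivators with strict morphisms. -/
def IsStrongEquivalence (φ : D ⟶ D') : Prop :=
  ∃ ψ : D' ⟶ D,
    Relation.EqvGen ElementaryHomotopic (φ ≫ ψ) (𝟙 D) ∧
    Relation.EqvGen ElementaryHomotopic (ψ ≫ φ) (𝟙 D')

end Prederivator

section Localization

variable {M : Type u} [Category.{w} M] (W : MorphismProperty M)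

/-- The functor on localizations of diagram categories induced by precomposition with `F`. -/
noncomputable def hoMap {I J : Type w} [SmallCategory I] [SmallCategory J] (F : I ⥤ J) :
    (W.functorCategory J).Localization ⥤ (W.functorCategory I).Localization :=
  Localization.Construction.lift
    ((Functor.whiskeringLeft I J M).obj F ⋙ (W.functorCategory I).Q)
    (fun _ _ f hf => (W.functorCategory I).Q_inverts
      (((Functor.whiskeringLeft I J M).obj F).map f) (fun i => hf (F.obj i)))

theorem Q_hoMap {I J : Type w} [SmallCategory I] [SmallCategory J] (F : I ⥤ J) :
    (W.functorCategory J).Q ⋙ hoMap W F =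
      (Functor.whiskeringLeft I J M).obj F ⋙ (W.functorCategory I).Q :=
  Localization.Construction.fac _ _

/-- The natural transformation on localizations of diagram categories induced by `α`. -/
noncomputable def hoMap₂ {I J : Type w} [SmallCategory I] [SmallCategory J] {F G : I ⥤ J} (α : F ⟶ G) :
    hoMap W F ⟶ hoMap W G :=
  Localization.Construction.natTransExtension
    (eqToHom (Q_hoMap W F) ≫
      Functor.whiskerRight ((Functor.whiskeringLeft I J M).map α) (W.functorCategory I).Q ≫
      eqToHom (Q_hoMap W G).symm)

theorem hoMap_map_Q {I J : Type w} [SmallCategory I] [SmallCategory J] (F : I ⥤ J)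
    {X Y : J ⥤ M} (f : X ⟶ Y) :
    (hoMap W F).map ((W.functorCategory J).Q.map f) =
      (W.functorCategory I).Q.map (Functor.whiskerLeft F f) := by
  have h := Functor.congr_hom (Q_hoMap W F) f
  refine h.trans ?_
  erw [eqToHom_refl, eqToHom_refl, Category.id_comp, Category.comp_id]
  rfl

theorem hoMap₂_app_Q {I J : Type w} [SmallCategory I] [SmallCategory J] {F G : I ⥤ J}
    (α : F ⟶ G) (X : J ⥤ M) :
    (hoMap₂ W α).app ((W.functorCategory J).Q.obj X) =
      (W.functorCategory I).Q.map (Functor.whiskerRight α X) := by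
  refine (Localization.Construction.NatTransExtension.app_eq _ X).trans ?_
  rw [NatTrans.comp_app, NatTrans.comp_app, eqToHom_app, eqToHom_app]
  erw [eqToHom_refl, eqToHom_refl, Category.id_comp, Category.comp_id]
  rfl

theorem natTrans_ext_Q {C : Type u₁} [Category.{v₁} C] {S : MorphismProperty C} {E : Type u₂}
    [Category.{v₂} E] {F G : S.Localization ⥤ E} {α β : F ⟶ G}
    (h : ∀ X : C, α.app (S.Q.obj X) = β.app (S.Q.obj X)) : α = β := by
  ext X
  obtain ⟨Y, rfl⟩ := (Localization.Construction.objEquiv S).surjective X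
  exact h Y

/-- The prederivator induced by `(M, W)`: it sends `I` to the localization of `I ⥤ M` at the
objectwise weak equivalences. -/
noncomputable def HO : Prederivator.{w, max u w, max u w} where
  obj I _ := (W.functorCategory I).Localization
  cat I _ := inferInstance
  map F := hoMap W F
  map₂ α := hoMap₂ W α
  map_id I _ := Localization.Construction.uniq _ _ (Q_hoMap W (𝟭 I))
  map_comp {I J K} _ _ _ F G := by
    apply Localization.Construction.uniq
    rw [Q_hoMap, ← Functor.assoc, Q_hoMap, Functor.assoc, Q_hoMap]
    rfl
  map₂_id F := by
    apply natTrans_ext_Q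
    intro X
    rw [hoMap₂_app_Q, Functor.whiskerRight_id']
    exact (W.functorCategory _).Q.map_id _
  map₂_comp α β := by
    apply natTrans_ext_Q
    intro X
    rw [NatTrans.comp_app, hoMap₂_app_Q, hoMap₂_app_Q, hoMap₂_app_Q,
      Functor.whiskerRight_comp]
    exact (W.functorCategory _).Q.map_comp _ _
  map₂_whiskerLeft F G H α := by
    apply natTrans_ext_Q
    intro X
    rw [NatTrans.comp_app, NatTrans.comp_app, eqToHom_app, eqToHom_app,
      Functor.whiskerRight_app, hoMap₂_app_Q, hoMap₂_app_Q]
    erw [hoMap_map_Q, eqToHom_refl, eqToHom_refl, Category.id_comp, Category.comp_id]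
    rfl
  map₂_whiskerRight α H := by
    apply natTrans_ext_Q
    intro X
    rw [NatTrans.comp_app, NatTrans.comp_app, eqToHom_app, eqToHom_app,
      Functor.whiskerLeft_app, hoMap₂_app_Q]
    erw [eqToHom_refl, eqToHom_refl, Category.id_comp, Category.comp_id]
    exact (hoMap₂_app_Q W α (H ⋙ X)).symm

/-- The localization functor from `I`-shaped diagrams to the value of `HO W` at `I`. -/
noncomputable def HO.Q (I : Type w) [SmallCategory I] : (I ⥤ M) ⥤ (HO W).obj I := (W.functorCategory I).Q

/-- `(M, W)` induces a derivator: each localization of a diagram category has small hom-sets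
(it is a category, in the sense that requires hom-sets), and the resulting prederivator is a
derivator. -/
structure InducesDerivator : Prop where
  locallySmall (I : Type w) [SmallCategory I] :
    LocallySmall.{w} (W.functorCategory I).Localization
  isDerivator : (HO W).IsDerivator

end Localization

/-- The exponential law `(M^L)^I ⥤ M^(L × I)`, sending `X` to `(l, i) ↦ X(i)(l)`. -/
def expLaw (L I : Type w) [SmallCategory L] [SmallCategory I] (M : Type u) [Category.{v} M] :
    (I ⥤ L ⥤ M) ⥤ (L × I ⥤ M) :=
  flipFunctor I L M ⋙ Functor.uncurry

/-!
The exponential law `(M^L)^I ≅ M^(L × I)` is an isomorphism of categories that identifies the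
objectwise weak equivalences on both sides. It therefore descends to the localizations, where it is
strictly compatible with restriction functors and natural transformations, and identifies
`HO (M^L)` with the shift of `HO M` by `L`. The derivator axioms are invariant under strict
morphisms consisting of equivalences, so all that remains is that the shift of a derivator is a
derivator. There only the pointwise formula for Kan extensions needs an argument: the base change
along `L × F/k ⥤ L × e` is tested at an object `l`, where, pasted with the comma square of
`L × F/k ⥤ L × e` over `l`, it becomes the base change for the comma square of `L × F` over
`(l, k)`.
-/

section BeckChevalley

open Functor

variable {A B C D E F : Type*} [Category* A] [Category* B] [Category* C] [Category* D]
  [Category* E] [Category* F]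

/-- A square `R₁ ⋙ G ⟶ H ⋙ R₂` satisfies the left Beck–Chevalley condition if its mate
`G ⋙ L₂ ⟶ L₁ ⋙ H` is invertible, for all left adjoints `L₁` of `R₁` and `L₂` of `R₂`. -/
def LeftBeckChevalley {R₁ : B ⥤ A} {H : B ⥤ D} {G : A ⥤ C} {R₂ : D ⥤ C}
    (s : TwoSquare R₁ H G R₂) : Prop :=
  ∀ (L₁ : A ⥤ B) (adj₁ : L₁ ⊣ R₁) (L₂ : C ⥤ D) (adj₂ : L₂ ⊣ R₂),
    IsIso ((mateEquiv adj₁ adj₂).symm s).natTrans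

/-- A square `G ⋙ L₂ ⟶ L₁ ⋙ H` satisfies the right Beck–Chevalley condition if its mate
`R₁ ⋙ G ⟶ H ⋙ R₂` is invertible, for all right adjoints `R₁` of `L₁` and `R₂` of `L₂`. -/
def RightBeckChevalley {G : A ⥤ C} {L₁ : A ⥤ B} {L₂ : C ⥤ D} {H : B ⥤ D}
    (s : TwoSquare G L₁ L₂ H) : Prop :=
  ∀ (R₁ : B ⥤ A) (adj₁ : L₁ ⊣ R₁) (R₂ : D ⥤ C) (adj₂ : L₂ ⊣ R₂),
    IsIso (mateEquiv adj₁ adj₂ s).natTrans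

section Mates

variable {L₁ : A ⥤ B} {R₁ : B ⥤ A} {L₂ : C ⥤ D} {R₂ : D ⥤ C} {G : A ⥤ C} {H : B ⥤ D}
  (adj₁ : L₁ ⊣ R₁) (adj₂ : L₂ ⊣ R₂)

theorem mateEquiv_app (s : TwoSquare G L₁ L₂ H) (X : B) :
    (mateEquiv adj₁ adj₂ s).natTrans.app X =
      adj₂.unit.app (G.obj (R₁.obj X)) ≫
        R₂.map (s.natTrans.app (R₁.obj X) ≫ H.map (adj₁.counit.app X)) := by
  simp

theorem mateEquiv_symm_app (s : TwoSquare R₁ H G R₂) (X : A) :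
    ((mateEquiv adj₁ adj₂).symm s).natTrans.app X =
      L₂.map (G.map (adj₁.unit.app X) ≫ s.natTrans.app (L₁.obj X)) ≫
        adj₂.counit.app (H.obj (L₁.obj X)) := by
  simp

theorem isIso_mateEquiv (s : TwoSquare G L₁ L₂ H) [IsIso adj₁.counit] [IsIso adj₂.unit]
    [IsIso s.natTrans] : IsIso (mateEquiv adj₁ adj₂ s).natTrans := by
  rw [NatTrans.isIso_iff_isIso_app]
  intro X
  rw [mateEquiv_app]
  infer_instance

theorem isIso_mateEquiv_symm (s : TwoSquare R₁ H G R₂) [IsIso adj₁.unit] [IsIso adj₂.counit]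
    [IsIso s.natTrans] : IsIso ((mateEquiv adj₁ adj₂).symm s).natTrans := by
  rw [NatTrans.isIso_iff_isIso_app]
  intro X
  rw [mateEquiv_symm_app]
  infer_instance

end Mates

section Left

variable {R₁ : B ⥤ A} {R₂ : D ⥤ C} {R₃ : F ⥤ E} {G₁ : A ⥤ C} {G₂ : C ⥤ E} {H₁ : B ⥤ D}
  {H₂ : D ⥤ F}

theorem mateEquiv_symm_vComp_app {L₁ : A ⥤ B} {L₂ : C ⥤ D} {L₃ : E ⥤ F} (adj₁ : L₁ ⊣ R₁)
    (adj₂ : L₂ ⊣ R₂) (adj₃ : L₃ ⊣ R₃) (s : TwoSquare R₁ H₁ G₁ R₂) (t : TwoSquare R₂ H₂ G₂ R₃)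
    (X : A) :
    ((mateEquiv adj₁ adj₃).symm (s.vComp t)).natTrans.app X =
      ((mateEquiv adj₂ adj₃).symm t).natTrans.app (G₁.obj X) ≫
        H₂.map (((mateEquiv adj₁ adj₂).symm s).natTrans.app X) := by
  have mate_vComp : (mateEquiv adj₁ adj₃).symm (s.vComp t) =
      ((mateEquiv adj₁ adj₂).symm s).hComp ((mateEquiv adj₂ adj₃).symm t) := by
    rw [Equiv.symm_apply_eq, mateEquiv_vcomp adj₁ adj₂ adj₃, Equiv.apply_symm_apply,
      Equiv.apply_symm_apply]
  simp [mate_vComp, TwoSquare.hComp]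

namespace LeftBeckChevalley

variable {s : TwoSquare R₁ H₁ G₁ R₂} {t : TwoSquare R₂ H₂ G₂ R₃}

-- Taking the mate of the mate along the adjunctions of `G₁` and `H₁` yields the conjugate of `s`.
theorem of_isEquivalence (s : TwoSquare R₁ H₁ G₁ R₂) [G₁.IsEquivalence] [H₁.IsEquivalence]
    [IsIso s.natTrans] : LeftBeckChevalley s := by
  intro L₁ adj₁ L₂ adj₂
  have adjG : G₁.inv ⊣ G₁ := G₁.asEquivalence.symm.toAdjunction
  have adjH : H₁.inv ⊣ H₁ := H₁.asEquivalence.symm.toAdjunction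
  have : IsIso ((mateEquiv adjG adjH).symm ((mateEquiv adj₁ adj₂).symm s)).natTrans := by
    rw [iterated_mateEquiv_conjugateEquiv_symm]
    exact conjugateEquiv_symm_iso (adjG.comp adj₁) (adj₂.comp adjH) s.natTrans
  rw [← (mateEquiv adjG adjH).apply_symm_apply ((mateEquiv adj₁ adj₂).symm s)]
  exact isIso_mateEquiv adjG adjH _

theorem of_iso (hs : LeftBeckChevalley s) {G : A ⥤ C} {H : B ⥤ D} {s' : TwoSquare R₁ H G R₂}
    (eG : G ≅ G₁) (eH : H₁ ≅ H)
    (h : ∀ X, s'.natTrans.app X =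
      eG.hom.app (R₁.obj X) ≫ s.natTrans.app X ≫ R₂.map (eH.hom.app X)) :
    LeftBeckChevalley s' := by
  intro L₁ adj₁ L₂ adj₂
  rw [NatTrans.isIso_iff_isIso_app]
  intro X
  have := hs L₁ adj₁ L₂ adj₂
  have mate_app : ((mateEquiv adj₁ adj₂).symm s').natTrans.app X =
      L₂.map (eG.hom.app X) ≫ ((mateEquiv adj₁ adj₂).symm s).natTrans.app X ≫
        eH.hom.app (L₁.obj X) := by
    have hG : G.map (adj₁.unit.app X) ≫ eG.hom.app (R₁.obj (L₁.obj X)) =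
        eG.hom.app X ≫ G₁.map (adj₁.unit.app X) := eG.hom.naturality (adj₁.unit.app X)
    rw [mateEquiv_symm_app, mateEquiv_symm_app, h, ← Category.assoc (G.map _), hG]
    simp
  rw [mate_app]
  infer_instance

theorem vComp [R₂.IsRightAdjoint] (hs : LeftBeckChevalley s) (ht : LeftBeckChevalley t) :
    LeftBeckChevalley (s.vComp t) := by
  intro L₁ adj₁ L₃ adj₃
  rw [NatTrans.isIso_iff_isIso_app]
  intro X
  rw [mateEquiv_symm_vComp_app adj₁ (Adjunction.ofIsRightAdjoint R₂)]
  have := hs _ adj₁ _ (Adjunction.ofIsRightAdjoint R₂)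
  have := ht _ (Adjunction.ofIsRightAdjoint R₂) _ adj₃
  infer_instance

theorem isIso_map_mate_app [R₃.IsRightAdjoint] (ht : LeftBeckChevalley t)
    (hst : LeftBeckChevalley (s.vComp t)) {L₁ : A ⥤ B} {L₂ : C ⥤ D} (adj₁ : L₁ ⊣ R₁)
    (adj₂ : L₂ ⊣ R₂) (X : A) :
    IsIso (H₂.map (((mateEquiv adj₁ adj₂).symm s).natTrans.app X)) := by
  have adj₃ := Adjunction.ofIsRightAdjoint R₃
  have := ht _ adj₂ _ adj₃
  have := hst _ adj₁ _ adj₃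
  exact IsIso.of_isIso_fac_left (mateEquiv_symm_vComp_app adj₁ adj₂ adj₃ s t X).symm

theorem of_vComp_left [R₃.IsRightAdjoint] [H₂.ReflectsIsomorphisms]
    (ht : LeftBeckChevalley t) (hst : LeftBeckChevalley (s.vComp t)) : LeftBeckChevalley s := by
  intro L₁ adj₁ L₂ adj₂
  rw [NatTrans.isIso_iff_isIso_app]
  intro X
  have := ht.isIso_map_mate_app hst adj₁ adj₂ X
  exact isIso_of_reflects_iso _ H₂

theorem of_vComp_right [R₁.IsRightAdjoint] [G₁.EssSurj]
    (hs : LeftBeckChevalley s) (hst : LeftBeckChevalley (s.vComp t)) : LeftBeckChevalley t := by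
  intro L₂ adj₂ L₃ adj₃
  have adj₁ := Adjunction.ofIsRightAdjoint R₁
  have := hs _ adj₁ _ adj₂
  have := hst _ adj₁ _ adj₃
  rw [NatTrans.isIso_iff_isIso_app]
  intro Y
  have : IsIso (((mateEquiv adj₂ adj₃).symm t).natTrans.app (G₁.obj (G₁.objPreimage Y))) :=
    IsIso.of_isIso_fac_right (mateEquiv_symm_vComp_app adj₁ adj₂ adj₃ s t _).symm
  exact (NatTrans.isIso_app_iff_of_iso _ (G₁.objObjPreimageIso Y)).1 this

end LeftBeckChevalley

end Left

section Right

variable {L₁ : A ⥤ B} {L₂ : C ⥤ D} {L₃ : E ⥤ F} {G₁ : A ⥤ C} {G₂ : C ⥤ E} {H₁ : B ⥤ D}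
  {H₂ : D ⥤ F}

theorem mateEquiv_hComp_app {R₁ : B ⥤ A} {R₂ : D ⥤ C} {R₃ : F ⥤ E} (adj₁ : L₁ ⊣ R₁)
    (adj₂ : L₂ ⊣ R₂) (adj₃ : L₃ ⊣ R₃) (s : TwoSquare G₁ L₁ L₂ H₁) (t : TwoSquare G₂ L₂ L₃ H₂)
    (X : B) :
    (mateEquiv adj₁ adj₃ (s.hComp t)).natTrans.app X =
      G₂.map ((mateEquiv adj₁ adj₂ s).natTrans.app X) ≫
        (mateEquiv adj₂ adj₃ t).natTrans.app (H₁.obj X) := by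
  rw [mateEquiv_vcomp adj₁ adj₂ adj₃]
  simp [TwoSquare.vComp, -mateEquiv_apply]

namespace RightBeckChevalley

variable {s : TwoSquare G₁ L₁ L₂ H₁} {t : TwoSquare G₂ L₂ L₃ H₂}

theorem of_isEquivalence (s : TwoSquare G₁ L₁ L₂ H₁) [G₁.IsEquivalence] [H₁.IsEquivalence]
    [IsIso s.natTrans] : RightBeckChevalley s := by
  intro R₁ adj₁ R₂ adj₂
  have adjG : G₁ ⊣ G₁.inv := G₁.asEquivalence.toAdjunction
  have adjH : H₁ ⊣ H₁.inv := H₁.asEquivalence.toAdjunction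
  have : IsIso (mateEquiv adjH adjG (mateEquiv adj₁ adj₂ s)).natTrans := by
    rw [iterated_mateEquiv_conjugateEquiv]
    exact conjugateEquiv_iso (adj₁.comp adjH) (adjG.comp adj₂) s.natTrans
  rw [← (mateEquiv adjH adjG).symm_apply_apply (mateEquiv adj₁ adj₂ s)]
  exact isIso_mateEquiv_symm adjH adjG _

theorem of_iso (hs : RightBeckChevalley s) {G : A ⥤ C} {H : B ⥤ D} {s' : TwoSquare G L₁ L₂ H}
    (eG : G ≅ G₁) (eH : H₁ ≅ H)
    (h : ∀ X, s'.natTrans.app X =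
      L₂.map (eG.hom.app X) ≫ s.natTrans.app X ≫ eH.hom.app (L₁.obj X)) :
    RightBeckChevalley s' := by
  intro R₁ adj₁ R₂ adj₂
  rw [NatTrans.isIso_iff_isIso_app]
  intro X
  have := hs R₁ adj₁ R₂ adj₂
  have mate_app : (mateEquiv adj₁ adj₂ s').natTrans.app X =
      eG.hom.app (R₁.obj X) ≫ (mateEquiv adj₁ adj₂ s).natTrans.app X ≫
        R₂.map (eH.hom.app X) := by
    have hH : R₂.map (eH.hom.app (L₁.obj (R₁.obj X))) ≫ R₂.map (H.map (adj₁.counit.app X)) =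
        R₂.map (H₁.map (adj₁.counit.app X)) ≫ R₂.map (eH.hom.app X) := by
      rw [← R₂.map_comp, ← R₂.map_comp]
      exact congrArg R₂.map (eH.hom.naturality (adj₁.counit.app X)).symm
    simp [h, hH]
  rw [mate_app]
  infer_instance

theorem hComp [L₂.IsLeftAdjoint] (hs : RightBeckChevalley s) (ht : RightBeckChevalley t) :
    RightBeckChevalley (s.hComp t) := by
  intro R₁ adj₁ R₃ adj₃
  rw [NatTrans.isIso_iff_isIso_app]
  intro X
  rw [mateEquiv_hComp_app adj₁ (Adjunction.ofIsLeftAdjoint L₂)]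
  have := hs _ adj₁ _ (Adjunction.ofIsLeftAdjoint L₂)
  have := ht _ (Adjunction.ofIsLeftAdjoint L₂) _ adj₃
  infer_instance

theorem isIso_map_mate_app [L₃.IsLeftAdjoint] (ht : RightBeckChevalley t)
    (hst : RightBeckChevalley (s.hComp t)) {R₁ : B ⥤ A} {R₂ : D ⥤ C} (adj₁ : L₁ ⊣ R₁)
    (adj₂ : L₂ ⊣ R₂) (X : B) :
    IsIso (G₂.map ((mateEquiv adj₁ adj₂ s).natTrans.app X)) := by
  have adj₃ := Adjunction.ofIsLeftAdjoint L₃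
  have := ht _ adj₂ _ adj₃
  have := hst _ adj₁ _ adj₃
  exact IsIso.of_isIso_fac_right (mateEquiv_hComp_app adj₁ adj₂ adj₃ s t X).symm

theorem of_hComp_left [L₃.IsLeftAdjoint] [G₂.ReflectsIsomorphisms]
    (ht : RightBeckChevalley t) (hst : RightBeckChevalley (s.hComp t)) :
    RightBeckChevalley s := by
  intro R₁ adj₁ R₂ adj₂
  rw [NatTrans.isIso_iff_isIso_app]
  intro X
  have := ht.isIso_map_mate_app hst adj₁ adj₂ X
  exact isIso_of_reflects_iso _ G₂

theorem of_hComp_right [L₁.IsLeftAdjoint] [H₁.EssSurj]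
    (hs : RightBeckChevalley s) (hst : RightBeckChevalley (s.hComp t)) :
    RightBeckChevalley t := by
  intro R₂ adj₂ R₃ adj₃
  have adj₁ := Adjunction.ofIsLeftAdjoint L₁
  have := hs _ adj₁ _ adj₂
  have := hst _ adj₁ _ adj₃
  rw [NatTrans.isIso_iff_isIso_app]
  intro Y
  have : IsIso ((mateEquiv adj₂ adj₃ t).natTrans.app (H₁.obj (H₁.objPreimage Y))) :=
    IsIso.of_isIso_fac_left (mateEquiv_hComp_app adj₁ adj₂ adj₃ s t _).symm
  exact (NatTrans.isIso_app_iff_of_iso _ (H₁.objObjPreimageIso Y)).1 this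

end RightBeckChevalley

end Right

end BeckChevalley

namespace Prederivator

section Squares

variable (D : Prederivator.{w, v, u}) {A B I J J' K : Type w} [SmallCategory A] [SmallCategory B]
  [SmallCategory I] [SmallCategory J] [SmallCategory J'] [SmallCategory K]

/-- The isomorphism of restriction functors induced by an isomorphism of functors. -/
def mapIso {F G : I ⥤ J} (e : F ≅ G) : D.map F ≅ D.map G where
  hom := D.map₂ e.hom
  inv := D.map₂ e.inv
  hom_inv_id := by rw [← D.map₂_comp, e.hom_inv_id, D.map₂_id]
  inv_hom_id := by rw [← D.map₂_comp, e.inv_hom_id, D.map₂_id]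

instance isIso_map₂ {F G : I ⥤ J} (α : F ⟶ G) [IsIso α] : IsIso (D.map₂ α) :=
  (D.mapIso (asIso α)).isIso_hom

instance isEquivalence_map (F : I ⥤ J) [F.IsEquivalence] : (D.map F).IsEquivalence :=
  (CategoryTheory.Equivalence.mk (D.map F) (D.map F.inv)
    (eqToIso (D.map_id J).symm ≪≫ (D.mapIso F.asEquivalence.counitIso).symm ≪≫
      eqToIso (D.map_comp F.inv F))
    (eqToIso (D.map_comp F F.inv).symm ≪≫ (D.mapIso F.asEquivalence.unitIso).symm ≪≫
      eqToIso (D.map_id I))).isEquivalence_functor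

variable {P : A ⥤ I} {F : I ⥤ K} {Q : A ⥤ J} {G : J ⥤ K} (α : TwoSquare P Q F G)

theorem square_app (X : D.obj K) :
    (D.square α).natTrans.app X =
      eqToHom (by rw [D.map_comp]) ≫ (D.map₂ α).app X ≫ eqToHom (by rw [D.map_comp]) := by
  refine (NatTrans.comp_app _ _ X).trans ?_
  rw [NatTrans.comp_app, eqToHom_app, eqToHom_app]

instance isIso_square [IsIso α.natTrans] : IsIso (D.square α).natTrans := by
  have : IsIso (D.map₂ α) := D.isIso_map₂ α.natTrans
  exact inferInstanceAs (IsIso (eqToHom _ ≫ D.map₂ α ≫ eqToHom _))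

theorem leftBeckChevalley_vComp_square {R : B ⥤ A} {S : B ⥤ J'} {H : J' ⥤ J}
    (β : TwoSquare R S Q H) (h : LeftBeckChevalley (D.square (β.hComp α))) :
    LeftBeckChevalley ((D.square α).vComp (D.square β)) := by
  refine h.of_iso (eqToIso (D.map_comp R P).symm) (eqToIso (D.map_comp H G)) fun X => ?_
  have hComp_eq : β.hComp α =
      Functor.whiskerLeft R α.natTrans ≫ Functor.whiskerRight β.natTrans G := by
    ext
    simp [TwoSquare.hComp]
  have map₂_hComp := (congrArg D.map₂ hComp_eq).trans (D.map₂_comp _ _)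
  rw [D.map₂_whiskerLeft, D.map₂_whiskerRight] at map₂_hComp
  simp [square_app, map₂_hComp, TwoSquare.vComp, eqToHom_map]

theorem rightBeckChevalley_hComp_square {R : B ⥤ J'} {H : J' ⥤ I} {S : B ⥤ A}
    (β : TwoSquare R S H P) (h : RightBeckChevalley (D.square (β.vComp α))) :
    RightBeckChevalley ((D.square α).hComp (D.square β)) := by
  refine h.of_iso (eqToIso (D.map_comp H F).symm) (eqToIso (D.map_comp S Q)) fun X => ?_
  have vComp_eq : β.vComp α =
      Functor.whiskerRight β.natTrans F ≫ Functor.whiskerLeft S α.natTrans := by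
    ext
    simp [TwoSquare.vComp]
  have map₂_vComp := (congrArg D.map₂ vComp_eq).trans (D.map₂_comp _ _)
  rw [D.map₂_whiskerLeft, D.map₂_whiskerRight] at map₂_vComp
  simp [square_app, map₂_vComp, TwoSquare.hComp, eqToHom_map]

end Squares

theorem IsDerivator.leftBeckChevalley_comma {D : Prederivator.{w, v, u}} (hD : D.IsDerivator)
    {J K : Type w} [SmallCategory J] [SmallCategory K] (F : J ⥤ K) (k : K) :
    LeftBeckChevalley (D.square (Comma.natTrans F (pt k))) :=
  fun _ adjF _ adjπ => hD.der₄_left F k _ adjF _ adjπ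

theorem IsDerivator.rightBeckChevalley_comma {D : Prederivator.{w, v, u}} (hD : D.IsDerivator)
    {J K : Type w} [SmallCategory J] [SmallCategory K] (F : J ⥤ K) (k : K) :
    RightBeckChevalley (D.square (Comma.natTrans (pt k) F)) :=
  fun _ adjF _ adjπ => hD.der₄_right F k _ adjF _ adjπ

namespace StrictHom

variable {D D' : Prederivator.{w, v, u}} (φ : StrictHom D D')
  {A I J K : Type w} [SmallCategory A] [SmallCategory I] [SmallCategory J] [SmallCategory K]

/-- The naturality square of a strict morphism at `F`, read from the restriction along `F` in the
source to the one in the target. -/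
def natSquare (F : I ⥤ J) : TwoSquare (D.map F) (φ.app J) (φ.app I) (D'.map F) :=
  TwoSquare.mk _ _ _ _ (eqToHom (φ.naturality F))

/-- The naturality square of a strict morphism at `F`, read from the values of the morphism at the
target of `F` to those at its source. -/
def natSquareInv (F : I ⥤ J) : TwoSquare (φ.app J) (D.map F) (D'.map F) (φ.app I) :=
  TwoSquare.mk _ _ _ _ (eqToHom (φ.naturality F).symm)

instance (F : I ⥤ J) : IsIso (φ.natSquare F).natTrans :=
  inferInstanceAs (IsIso (eqToHom (φ.naturality F)))

instance (F : I ⥤ J) : IsIso (φ.natSquareInv F).natTrans :=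
  inferInstanceAs (IsIso (eqToHom (φ.naturality F).symm))

theorem app_obj_map_obj (F : I ⥤ J) (X : D.obj J) :
    (φ.app I).obj ((D.map F).obj X) = (D'.map F).obj ((φ.app J).obj X) :=
  Functor.congr_obj (φ.naturality F) X

theorem app_map_map₂ {F G : I ⥤ J} (α : F ⟶ G) (X : D.obj J) :
    (φ.app I).map ((D.map₂ α).app X) = eqToHom (φ.app_obj_map_obj F X) ≫
      (D'.map₂ α).app ((φ.app J).obj X) ≫ eqToHom (φ.app_obj_map_obj G X).symm := by
  simpa [eqToHom_app] using NatTrans.congr_app (φ.naturality₂ α) X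

section

variable {P : A ⥤ I} {F : I ⥤ K} {Q : A ⥤ J} {G : J ⥤ K} (α : TwoSquare P Q F G)

theorem app_map_square_app (X : D.obj K) :
    (φ.app A).map ((D.square α).natTrans.app X) =
      eqToHom (by simp only [Functor.comp_obj, φ.app_obj_map_obj]) ≫
        (D'.square α).natTrans.app ((φ.app K).obj X) ≫
        eqToHom (by simp only [Functor.comp_obj, φ.app_obj_map_obj]) := by
  have map_map₂ := φ.app_map_map₂ α.natTrans X
  simp [square_app, eqToHom_map, map_map₂]

theorem leftBeckChevalley_square [∀ (I : Type w) [SmallCategory I], (φ.app I).IsEquivalence]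
    [(D.map F).IsRightAdjoint] [(D.map Q).IsRightAdjoint]
    (h : LeftBeckChevalley (D.square α)) : LeftBeckChevalley (D'.square α) := by
  have hF := LeftBeckChevalley.of_isEquivalence (φ.natSquare F)
  have hQ := LeftBeckChevalley.of_isEquivalence (φ.natSquare Q)
  refine hF.of_vComp_right (t := D'.square α) ?_
  refine (h.vComp hQ).of_iso (eqToIso (φ.naturality P).symm) (eqToIso (φ.naturality G))
    fun X => ?_
  simp [TwoSquare.vComp, natSquare, eqToHom_app, eqToHom_map, φ.app_map_square_app]

theorem rightBeckChevalley_square [∀ (I : Type w) [SmallCategory I], (φ.app I).IsEquivalence]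
    [(D.map G).IsLeftAdjoint] [(D.map P).IsLeftAdjoint]
    (h : RightBeckChevalley (D.square α)) : RightBeckChevalley (D'.square α) := by
  have hG := RightBeckChevalley.of_isEquivalence (φ.natSquareInv G)
  have hP := RightBeckChevalley.of_isEquivalence (φ.natSquareInv P)
  refine hG.of_hComp_right (t := D'.square α) ?_
  refine (h.hComp hP).of_iso (eqToIso (φ.naturality F).symm) (eqToIso (φ.naturality Q))
    fun X => ?_
  simp [TwoSquare.hComp, natSquareInv, eqToHom_app, eqToHom_map, φ.app_map_square_app]

end

/-- A strict morphism consisting of equivalences conjugates the restriction functors of its source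
to those of its target. -/
noncomputable def conjIso (F : J ⥤ K) [(φ.app K).IsEquivalence] :
    (φ.app K).inv ⋙ D.map F ⋙ φ.app J ≅ D'.map F :=
  Functor.isoWhiskerLeft _ (eqToIso (φ.naturality F)) ≪≫ (Functor.associator _ _ _).symm ≪≫
    Functor.isoWhiskerRight (φ.app K).asEquivalence.counitIso (D'.map F) ≪≫ Functor.leftUnitor _

theorem isDerivator [∀ (I : Type w) [SmallCategory I], (φ.app I).IsEquivalence]
    (hD : D.IsDerivator) : D'.IsDerivator where
  der₁ {ι} I _ := by
    have := hD.der₁ I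
    have e : φ.app (Σ i, I i) ⋙ Functor.pi' (fun i => D'.map (Sigma.incl (C := I) i)) ≅
        Functor.pi' (fun i => D.map (Sigma.incl (C := I) i)) ⋙
          Functor.pi (fun i => φ.app (I i)) :=
      NatIso.pi' fun i => eqToIso (φ.naturality (Sigma.incl (C := I) i)).symm
    have := Functor.isEquivalence_of_iso e.symm
    exact Functor.isEquivalence_of_comp_left (φ.app (Σ i, I i)) _
  der₂ {J} _ {X Y} f h := by
    have : IsIso ((φ.app J).inv.map f) := hD.der₂ _ fun j => by
      have : IsIso ((φ.app Pt.{w}).map ((D.map (pt j)).map ((φ.app J).inv.map f))) :=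
        (NatIso.isIso_map_iff (φ.conjIso (pt j)) f).2 (h j)
      exact isIso_of_reflects_iso _ (φ.app Pt.{w})
    exact isIso_of_reflects_iso f (φ.app J).inv
  der₃_left F := by
    have := hD.der₃_left F
    exact Functor.isRightAdjoint_of_iso (φ.conjIso F)
  der₃_right F := by
    have := hD.der₃_right F
    exact Functor.isLeftAdjoint_of_iso (φ.conjIso F)
  der₄_left F k lF adjF lπ adjπ := by
    have := hD.der₃_left F
    have := hD.der₃_left (Comma.snd F (pt k))
    exact φ.leftBeckChevalley_square (Comma.natTrans F (pt k))
      (hD.leftBeckChevalley_comma F k) _ adjF _ adjπ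
  der₄_right F k rF adjF rπ adjπ := by
    have := hD.der₃_right F
    have := hD.der₃_right (Comma.fst (pt k) F)
    exact φ.rightBeckChevalley_square (Comma.natTrans (pt k) F)
      (hD.rightBeckChevalley_comma F k) _ adjF _ adjπ

end StrictHom

section Exactness

variable {D : Prederivator.{w, v, u}} {A B I J K : Type w} [SmallCategory A] [SmallCategory B]
  [SmallCategory I] [SmallCategory J] [SmallCategory K] {P : A ⥤ I} {F : I ⥤ K} {Q : A ⥤ J}
  {G : J ⥤ K} {α : TwoSquare P Q F G}

theorem IsDerivator.leftBeckChevalley_square_of_comma (hD : D.IsDerivator)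
    (h : ∀ j : J, LeftBeckChevalley (D.square (TwoSquare.hComp (Comma.natTrans Q (pt j)) α))) :
    LeftBeckChevalley (D.square α) := by
  intro lF adjF lQ adjQ
  rw [NatTrans.isIso_iff_isIso_app]
  refine fun X => hD.der₂ _ fun j => ?_
  have := hD.der₃_left (Comma.snd Q (pt j))
  exact (hD.leftBeckChevalley_comma Q j).isIso_map_mate_app
    (D.leftBeckChevalley_vComp_square α _ (h j)) adjF adjQ X

theorem IsDerivator.leftBeckChevalley_square_of_whiskerLeft (hD : D.IsDerivator) (E : B ⥤ A)
    [E.IsEquivalence]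
    (h : LeftBeckChevalley (D.square (P := E ⋙ P) (F := F) (Q := E ⋙ Q) (G := G)
      (Functor.whiskerLeft E α))) :
    LeftBeckChevalley (D.square α) := by
  have := hD.der₃_left (E ⋙ Q)
  let γ : TwoSquare E (E ⋙ Q) Q (𝟭 J) := 𝟙 (E ⋙ Q)
  have : IsIso γ.natTrans := inferInstanceAs (IsIso (𝟙 (E ⋙ Q)))
  have hComp_eq : γ.hComp α = Functor.whiskerLeft E α.natTrans := by
    ext
    simp [TwoSquare.hComp, γ]
  refine (LeftBeckChevalley.of_isEquivalence (D.square γ)).of_vComp_left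
    (D.leftBeckChevalley_vComp_square α γ ?_)
  rw [hComp_eq]
  exact h

theorem IsDerivator.rightBeckChevalley_square_of_comma (hD : D.IsDerivator)
    (h : ∀ i : I, RightBeckChevalley (D.square (TwoSquare.vComp (Comma.natTrans (pt i) P) α))) :
    RightBeckChevalley (D.square α) := by
  intro rG adjG rP adjP
  rw [NatTrans.isIso_iff_isIso_app]
  refine fun X => hD.der₂ _ fun i => ?_
  have := hD.der₃_right (Comma.fst (pt i) P)
  exact (hD.rightBeckChevalley_comma P i).isIso_map_mate_app
    (D.rightBeckChevalley_hComp_square α _ (h i)) adjG adjP X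

theorem IsDerivator.rightBeckChevalley_square_of_whiskerLeft (hD : D.IsDerivator) (E : B ⥤ A)
    [E.IsEquivalence]
    (h : RightBeckChevalley (D.square (P := E ⋙ P) (F := F) (Q := E ⋙ Q) (G := G)
      (Functor.whiskerLeft E α))) :
    RightBeckChevalley (D.square α) := by
  have := hD.der₃_right (E ⋙ P)
  let γ : TwoSquare (E ⋙ P) E (𝟭 I) P := 𝟙 (E ⋙ P)
  have : IsIso γ.natTrans := inferInstanceAs (IsIso (𝟙 (E ⋙ P)))
  have vComp_eq : γ.vComp α = Functor.whiskerLeft E α.natTrans := by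
    ext
    simp [TwoSquare.vComp, γ]
  refine (RightBeckChevalley.of_isEquivalence (D.square γ)).of_hComp_left
    (D.rightBeckChevalley_hComp_square α γ ?_)
  rw [vComp_eq]
  exact h

end Exactness

section Shift

variable {J K : Type w} [SmallCategory J] [SmallCategory K] (F : J ⥤ K) {L : Type w}
  [SmallCategory L] (l : L) (k : K)

/-- The comma category of `L × F` over `(l, k)` is the comma category over `l` of the projection
`L × F/k ⥤ L × e`. -/
def commaProdLeft :
    Comma ((𝟭 L).prod F) (pt (l, k)) ≌
      Comma ((𝟭 L).prod (Comma.snd F (pt k))) (pt ((l, ⟨⟨⟩⟩) : L × Pt.{w})) where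
  functor :=
    { obj x :=
        { left := (x.left.1, { left := x.left.2, right := ⟨⟨⟩⟩, hom := x.hom.2 })
          right := x.right
          hom := Prod.mkHom x.hom.1 (𝟙 _) }
      map f :=
        { left := Prod.mkHom f.left.1
            { left := f.left.2, right := 𝟙 _, w := congrArg Prod.snd f.w }
          right := f.right
          w := Prod.ext (Prod.ext_iff.1 f.w).1 (Subsingleton.elim _ _) } }
  inverse :=
    { obj x :=
        { left := (x.left.1, x.left.2.left)
          right := x.right
          hom := Prod.mkHom x.hom.1 x.left.2.hom }
      map f :=
        { left := Prod.mkHom f.left.1 f.left.2.left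
          right := f.right
          w := Prod.ext (Prod.ext_iff.1 f.w).1 f.left.2.w } }
  unitIso := Iso.refl _
  counitIso := Iso.refl _

/-- The comma category of `L × F` under `(l, k)` is the comma category under `l` of the projection
`L × k/F ⥤ L × e`. -/
def commaProdRight :
    Comma (pt (l, k)) ((𝟭 L).prod F) ≌
      Comma (pt ((l, ⟨⟨⟩⟩) : L × Pt.{w})) ((𝟭 L).prod (Comma.fst (pt k) F)) where
  functor :=
    { obj x :=
        { left := x.left
          right := (x.right.1, { left := ⟨⟨⟩⟩, right := x.right.2, hom := x.hom.2 })
          hom := Prod.mkHom x.hom.1 (𝟙 _) }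
      map f :=
        { left := f.left
          right := Prod.mkHom f.right.1
            { left := 𝟙 _, right := f.right.2, w := congrArg Prod.snd f.w }
          w := Prod.ext (Prod.ext_iff.1 f.w).1 (Subsingleton.elim _ _) } }
  inverse :=
    { obj x :=
        { left := x.left
          right := (x.right.1, x.right.2.right)
          hom := Prod.mkHom x.hom.1 x.right.2.hom }
      map f :=
        { left := f.left
          right := Prod.mkHom f.right.1 f.right.2.right
          w := Prod.ext (Prod.ext_iff.1 f.w).1 f.right.2.w } }
  unitIso := Iso.refl _
  counitIso := Iso.refl _

/-- The product of the identity square of `L` with a square. -/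
def prodTwoSquare (L : Type w) [SmallCategory L] {A I J K : Type w} [SmallCategory A]
    [SmallCategory I] [SmallCategory J] [SmallCategory K] {P : A ⥤ I} {Q : A ⥤ J} {F : I ⥤ K}
    {G : J ⥤ K} (α : TwoSquare P Q F G) :
    TwoSquare ((𝟭 L).prod P) ((𝟭 L).prod Q) ((𝟭 L).prod F) ((𝟭 L).prod G) :=
  NatTrans.prod (𝟙 (𝟭 L)) α.natTrans

theorem whiskerLeft_commaProdLeft :
    Functor.whiskerLeft (commaProdLeft F l k).functor
      (TwoSquare.hComp
        (Comma.natTrans ((𝟭 L).prod (Comma.snd F (pt k))) (pt ((l, ⟨⟨⟩⟩) : L × Pt.{w})))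
        (prodTwoSquare L (Comma.natTrans F (pt k)))).natTrans =
      Comma.natTrans ((𝟭 L).prod F) (pt (l, k)) := by
  ext x
  · simp [TwoSquare.hComp, prodTwoSquare, commaProdLeft]
  · have pad_ids (f : F.obj x.left.2 ⟶ k) : 𝟙 _ ≫ f ≫ 𝟙 k ≫ 𝟙 k ≫ 𝟙 k = f := by
      simp only [Category.id_comp, Category.comp_id]
    exact pad_ids x.hom.2

theorem IsDerivator.leftBeckChevalley_prod_comma {D : Prederivator.{w, v, u}}
    (hD : D.IsDerivator) :
    LeftBeckChevalley (D.square (prodTwoSquare L (Comma.natTrans F (pt k)))) := by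
  refine hD.leftBeckChevalley_square_of_comma fun ⟨l, ⟨⟨⟩⟩⟩ =>
    hD.leftBeckChevalley_square_of_whiskerLeft (commaProdLeft F l k).functor ?_
  have h := hD.leftBeckChevalley_comma ((𝟭 L).prod F) (l, k)
  rw [← whiskerLeft_commaProdLeft] at h
  exact h

theorem whiskerLeft_commaProdRight :
    Functor.whiskerLeft (commaProdRight F l k).functor
      (TwoSquare.vComp
        (Comma.natTrans (pt ((l, ⟨⟨⟩⟩) : L × Pt.{w})) ((𝟭 L).prod (Comma.fst (pt k) F)))
        (prodTwoSquare L (Comma.natTrans (pt k) F))).natTrans =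
      Comma.natTrans (pt (l, k)) ((𝟭 L).prod F) := by
  ext x
  · simp [TwoSquare.vComp, prodTwoSquare, commaProdRight]
  · have pad_ids (f : k ⟶ F.obj x.right.2) : 𝟙 k ≫ 𝟙 k ≫ 𝟙 k ≫ f ≫ 𝟙 _ = f := by
      simp only [Category.id_comp, Category.comp_id]
    exact pad_ids x.hom.2

theorem IsDerivator.rightBeckChevalley_prod_comma {D : Prederivator.{w, v, u}}
    (hD : D.IsDerivator) :
    RightBeckChevalley (D.square (prodTwoSquare L (Comma.natTrans (pt k) F))) := by
  refine hD.rightBeckChevalley_square_of_comma fun ⟨l, ⟨⟨⟩⟩⟩ =>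
    hD.rightBeckChevalley_square_of_whiskerLeft (commaProdRight F l k).functor ?_
  have h := hD.rightBeckChevalley_comma ((𝟭 L).prod F) (l, k)
  rw [← whiskerLeft_commaProdRight] at h
  exact h

variable (L)

/-- The distributivity comparison `∐ i, L × I i ⥤ L × ∐ i, I i`. -/
def sigmaProd {ι : Type w} (I : ι → Type w) [∀ i, SmallCategory (I i)] :
    (Σ i, L × I i) ⥤ L × Σ i, I i :=
  Sigma.desc fun i => (𝟭 L).prod (Sigma.incl i)

instance isEquivalence_sigmaProd {ι : Type w} (I : ι → Type w) [∀ i, SmallCategory (I i)] :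
    (sigmaProd L I).IsEquivalence where
  faithful :=
    { map_injective := by
        rintro _ _ ⟨f⟩ ⟨g⟩ h
        obtain ⟨h₁, h₂⟩ := Prod.ext_iff.1 h
        exact congrArg Sigma.SigmaHom.mk (Prod.ext h₁ ((Sigma.incl _).map_injective h₂)) }
  full :=
    { map_surjective := by
        rintro ⟨i, l, a⟩ ⟨j, l', b⟩ ⟨f, ⟨g⟩⟩
        exact ⟨Sigma.SigmaHom.mk (Prod.mkHom f g), rfl⟩ }
  essSurj :=
    { mem_essImage := fun ⟨l, i, a⟩ => ⟨⟨i, l, a⟩, ⟨Iso.refl _⟩⟩ }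

theorem IsDerivator.shift {D : Prederivator.{w, v, u}} (hD : D.IsDerivator) :
    (D.shift L).IsDerivator where
  der₁ {ι} I _ := by
    have := hD.der₁ fun i => L × I i
    have e : D.map (sigmaProd L I) ⋙
          Functor.pi' (fun i => D.map (Sigma.incl (C := fun i => L × I i) i)) ≅
        Functor.pi' (fun i => D.map ((𝟭 L).prod (Sigma.incl (C := I) i))) :=
      NatIso.pi' fun i =>
        eqToIso (D.map_comp (Sigma.incl (C := fun i => L × I i) i) (sigmaProd L I)).symm
    have := Functor.isEquivalence_trans (D.map (sigmaProd L I)) (Functor.pi' fun i =>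
        D.map (Sigma.incl (C := fun i => L × I i) i))
    exact (Functor.isEquivalence_of_iso e :)
  der₂ {J} _ {X Y} f h := by
    refine hD.der₂ (J := L × J) f fun ⟨l, j⟩ => ?_
    have e : D.map ((𝟭 L).prod (pt j)) ⋙ D.map (pt ((l, ⟨⟨⟩⟩) : L × Pt.{w})) ≅
        D.map (pt (l, j)) :=
      eqToIso (D.map_comp (pt ((l, ⟨⟨⟩⟩) : L × Pt.{w})) ((𝟭 L).prod (pt j))).symm
    have : IsIso ((D.map ((𝟭 L).prod (pt j))).map f) := h j
    exact (NatIso.isIso_map_iff e f).1 (inferInstanceAs (IsIso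
      ((D.map (pt ((l, ⟨⟨⟩⟩) : L × Pt.{w}))).map ((D.map ((𝟭 L).prod (pt j))).map f))))
  der₃_left F := hD.der₃_left ((𝟭 L).prod F)
  der₃_right F := hD.der₃_right ((𝟭 L).prod F)
  der₄_left F k _ adjF _ adjπ := hD.leftBeckChevalley_prod_comma F k _ adjF _ adjπ
  der₄_right F k _ adjF _ adjπ := hD.rightBeckChevalley_prod_comma F k _ adjF _ adjπ

end Shift

variable {D D' : Prederivator.{w, v, u}}

theorem map₂_app_congr (D : Prederivator.{w, v, u}) {I J : Type w} [SmallCategory I]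
    [SmallCategory J] {F G : I ⥤ J} (α : F ⟶ G) {X Y : D.obj J} (h : X = Y) :
    (D.map₂ α).app X = eqToHom (by rw [h]) ≫ (D.map₂ α).app Y ≫ eqToHom (by rw [h]) := by
  subst h
  simp

namespace StrictHom

/-- The strict morphism formed by strict inverses of the values of a strict morphism. -/
def inverse (φ : StrictHom D D') (ψ : ∀ (I : Type w) [SmallCategory I], D'.obj I ⥤ D.obj I)
    (app_comp : ∀ (I : Type w) [SmallCategory I], φ.app I ⋙ ψ I = 𝟭 _)
    (comp_app : ∀ (I : Type w) [SmallCategory I], ψ I ⋙ φ.app I = 𝟭 _) : StrictHom D' D where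
  app I _ := ψ I
  naturality {I J} _ _ F := by
    calc D'.map F ⋙ ψ I = (ψ J ⋙ φ.app J) ⋙ D'.map F ⋙ ψ I := by rw [comp_app]; rfl
      _ = ψ J ⋙ (φ.app J ⋙ D'.map F) ⋙ ψ I := rfl
      _ = ψ J ⋙ (D.map F ⋙ φ.app I) ⋙ ψ I := by rw [φ.naturality]
      _ = (ψ J ⋙ D.map F) ⋙ φ.app I ⋙ ψ I := rfl
      _ = ψ J ⋙ D.map F := by rw [app_comp]; rfl
  naturality₂ {I J} _ _ F G α := by
    ext X
    have : (φ.app I ⋙ ψ I).Faithful := by rw [app_comp]; infer_instance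
    have := Functor.Faithful.of_comp (φ.app I) (ψ I)
    apply (φ.app I).map_injective
    have app_inverse : (φ.app J).obj ((ψ J).obj X) = X := Functor.congr_obj (comp_app J) X
    have map_inverse := Functor.congr_hom (comp_app I) ((D'.map₂ α).app X)
    simp only [Functor.comp_map, Functor.id_map] at map_inverse
    simp [eqToHom_app, eqToHom_map, φ.app_map_map₂, map_inverse, D'.map₂_app_congr α app_inverse]

theorem isIso_of_app_comp_eq_id (φ : D ⟶ D')
    (ψ : ∀ (I : Type w) [SmallCategory I], D'.obj I ⥤ D.obj I)
    (app_comp : ∀ (I : Type w) [SmallCategory I], app φ I ⋙ ψ I = 𝟭 _)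
    (comp_app : ∀ (I : Type w) [SmallCategory I], ψ I ⋙ app φ I = 𝟭 _) : IsIso φ :=
  ⟨inverse φ ψ app_comp comp_app, StrictHom.ext (funext fun I => funext fun _ => app_comp I),
    StrictHom.ext (funext fun I => funext fun _ => comp_app I)⟩

instance isEquivalence_app (φ : D ⟶ D') [IsIso φ] (I : Type w) [SmallCategory I] :
    (app φ I).IsEquivalence := by
  have hom_inv_id : app φ I ⋙ app (inv φ) I = 𝟭 _ :=
    congrArg (fun ψ : D ⟶ D => app ψ I) (IsIso.hom_inv_id φ)
  have inv_hom_id : app (inv φ) I ⋙ app φ I = 𝟭 _ :=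
    congrArg (fun ψ : D' ⟶ D' => app ψ I) (IsIso.inv_hom_id φ)
  exact (CategoryTheory.Equivalence.mk (app φ I) (app (inv φ) I)
    (eqToIso hom_inv_id.symm) (eqToIso inv_hom_id)).isEquivalence_functor

end StrictHom

theorem isStrongEquivalence_of_isIso (φ : D ⟶ D') [IsIso φ] : IsStrongEquivalence φ := by
  refine ⟨inv φ, ?_, ?_⟩
  · rw [IsIso.hom_inv_id]
    exact Relation.EqvGen.refl _
  · rw [IsIso.inv_hom_id]
    exact Relation.EqvGen.refl _

end Prederivator

section Exponential

/-- The inverse of the exponential law. -/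
def expLawInv (L I : Type w) [SmallCategory L] [SmallCategory I] (M : Type u) [Category.{v} M] :
    (L × I ⥤ M) ⥤ (I ⥤ L ⥤ M) :=
  Functor.curry ⋙ flipFunctor L I M

theorem expLaw_comp_expLawInv (L I : Type w) [SmallCategory L] [SmallCategory I] (M : Type u)
    [Category.{v} M] : expLaw L I M ⋙ expLawInv L I M = 𝟭 _ := by
  have comp_obj (X : I ⥤ L ⥤ M) : (expLaw L I M ⋙ expLawInv L I M).obj X = (𝟭 _).obj X :=
    congrArg Functor.flip (Functor.curry_obj_uncurry_obj X.flip)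
  refine CategoryTheory.Functor.ext comp_obj fun X Y f => ?_
  ext i l
  rw [NatTrans.comp_app, NatTrans.comp_app, NatTrans.comp_app, NatTrans.comp_app, eqToHom_app,
    eqToHom_app, eqToHom_app, eqToHom_app]
  exact ((Category.id_comp _).trans (Category.comp_id _)).symm

theorem expLawInv_comp_expLaw (L I : Type w) [SmallCategory L] [SmallCategory I] (M : Type u)
    [Category.{v} M] : expLawInv L I M ⋙ expLaw L I M = 𝟭 _ := by
  have comp_obj (X : L × I ⥤ M) : (expLawInv L I M ⋙ expLaw L I M).obj X = (𝟭 _).obj X :=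
    Functor.uncurry_obj_curry_obj X
  refine CategoryTheory.Functor.ext comp_obj fun X Y f => ?_
  ext ⟨l, i⟩
  rw [NatTrans.comp_app, NatTrans.comp_app, eqToHom_app, eqToHom_app]
  exact ((Category.id_comp _).trans (Category.comp_id _)).symm

variable {M : Type u} [Category.{w} M] (W : MorphismProperty M) (L : Type w) [SmallCategory L]

/-- The exponential law on localizations. -/
noncomputable def hoExp (I : Type w) [SmallCategory I] :
    ((W.functorCategory L).functorCategory I).Localization ⥤
      (W.functorCategory (L × I)).Localization :=
  Localization.Construction.lift (expLaw L I M ⋙ (W.functorCategory (L × I)).Q)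
    (fun _ _ f hf => (W.functorCategory (L × I)).Q_inverts ((expLaw L I M).map f)
      (fun x => hf x.2 x.1))

theorem Q_comp_hoExp (I : Type w) [SmallCategory I] :
    ((W.functorCategory L).functorCategory I).Q ⋙ hoExp W L I =
      expLaw L I M ⋙ (W.functorCategory (L × I)).Q :=
  Localization.Construction.fac _ _

/-- The inverse exponential law on localizations. -/
noncomputable def hoExpInv (I : Type w) [SmallCategory I] :
    (W.functorCategory (L × I)).Localization ⥤
      ((W.functorCategory L).functorCategory I).Localization :=
  Localization.Construction.lift
    (expLawInv L I M ⋙ ((W.functorCategory L).functorCategory I).Q)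
    (fun _ _ f hf => ((W.functorCategory L).functorCategory I).Q_inverts ((expLawInv L I M).map f)
      (fun i l => hf (l, i)))

theorem Q_comp_hoExpInv (I : Type w) [SmallCategory I] :
    (W.functorCategory (L × I)).Q ⋙ hoExpInv W L I =
      expLawInv L I M ⋙ ((W.functorCategory L).functorCategory I).Q :=
  Localization.Construction.fac _ _

theorem hoExp_comp_hoExpInv (I : Type w) [SmallCategory I] :
    hoExp W L I ⋙ hoExpInv W L I = 𝟭 _ := by
  apply Localization.Construction.uniq
  rw [← Functor.assoc, Q_comp_hoExp, Functor.assoc, Q_comp_hoExpInv, ← Functor.assoc,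
    expLaw_comp_expLawInv]
  rfl

theorem hoExpInv_comp_hoExp (I : Type w) [SmallCategory I] :
    hoExpInv W L I ⋙ hoExp W L I = 𝟭 _ := by
  apply Localization.Construction.uniq
  rw [← Functor.assoc, Q_comp_hoExpInv, Functor.assoc, Q_comp_hoExp, ← Functor.assoc,
    expLawInv_comp_expLaw]
  rfl

theorem hoExp_map_Q {I : Type w} [SmallCategory I] {X Y : I ⥤ L ⥤ M} (f : X ⟶ Y) :
    (hoExp W L I).map (((W.functorCategory L).functorCategory I).Q.map f) =
      (W.functorCategory (L × I)).Q.map ((expLaw L I M).map f) :=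
  (Functor.congr_hom (Q_comp_hoExp W L I) f).trans
    ((Category.id_comp _).trans (Category.comp_id _))

theorem hoMap_comp_hoExp {I J : Type w} [SmallCategory I] [SmallCategory J] (F : I ⥤ J) :
    hoMap (W.functorCategory L) F ⋙ hoExp W L I = hoExp W L J ⋙ hoMap W ((𝟭 L).prod F) := by
  apply Localization.Construction.uniq
  rw [← Functor.assoc, ← Functor.assoc, Q_hoMap, Functor.assoc, Q_comp_hoExp, Q_comp_hoExp,
    Functor.assoc, Q_hoMap]
  rfl

theorem expLaw_map_whiskerRight {I J : Type w} [SmallCategory I] [SmallCategory J] {F G : I ⥤ J}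
    (α : F ⟶ G) (X : J ⥤ L ⥤ M) :
    (expLaw L I M).map (Functor.whiskerRight α X) =
      Functor.whiskerRight (NatTrans.prod (𝟙 (𝟭 L)) α) ((expLaw L J M).obj X) := by
  ext ⟨l, i⟩
  simp [expLaw]

theorem whiskerRight_hoMap₂_hoExp {I J : Type w} [SmallCategory I] [SmallCategory J]
    {F G : I ⥤ J} (α : F ⟶ G) :
    Functor.whiskerRight (hoMap₂ (W.functorCategory L) α) (hoExp W L I) =
      eqToHom (hoMap_comp_hoExp W L F) ≫
        Functor.whiskerLeft (hoExp W L J) (hoMap₂ W (NatTrans.prod (𝟙 (𝟭 L)) α)) ≫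
          eqToHom (hoMap_comp_hoExp W L G).symm := by
  refine natTrans_ext_Q fun X => ?_
  rw [NatTrans.comp_app, NatTrans.comp_app, eqToHom_app, eqToHom_app]
  refine Eq.trans ?_ ((Category.id_comp _).trans (Category.comp_id _)).symm
  change (hoExp W L I).map ((hoMap₂ (W.functorCategory L) α).app
      (((W.functorCategory L).functorCategory J).Q.obj X)) =
    (hoMap₂ W (NatTrans.prod (𝟙 (𝟭 L)) α)).app
      ((W.functorCategory (L × J)).Q.obj ((expLaw L J M).obj X))
  rw [hoMap₂_app_Q, hoMap₂_app_Q, ← expLaw_map_whiskerRight]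
  exact hoExp_map_Q W L (Functor.whiskerRight α X)

/-- The canonical strict morphism from the prederivator of `M^L` to the shift of that of `M`. -/
noncomputable def HO.exp : HO (W.functorCategory L) ⟶ (HO W).shift L where
  app I _ := hoExp W L I
  naturality F := hoMap_comp_hoExp W L F
  naturality₂ α := whiskerRight_hoMap₂_hoExp W L α

instance : IsIso (HO.exp W L) :=
  Prederivator.StrictHom.isIso_of_app_comp_eq_id _ (fun I _ => hoExpInv W L I)
    (fun I _ => hoExp_comp_hoExpInv W L I) (fun I _ => hoExpInv_comp_hoExp W L I)

variable {W} in
theorem InducesDerivator.functorCategory (hW : InducesDerivator W) :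
    InducesDerivator (W.functorCategory L) where
  locallySmall I _ := by
    have := hW.locallySmall (L × I)
    have : (hoExp W L I).IsEquivalence :=
      Prederivator.StrictHom.isEquivalence_app (HO.exp W L) I
    exact locallySmall_of_faithful (hoExp W L I)
  isDerivator := Prederivator.StrictHom.isDerivator (inv (HO.exp W L)) (hW.isDerivator.shift L)

end Exponential

theorem mainTheorem2 {M : Type u} [Category.{w} M] (W : MorphismProperty M)
    (L : Type w) [SmallCategory L] (hW : InducesDerivator W) :
    InducesDerivator (W.functorCategory L) ∧
    ((HO W).shift L).IsDerivator ∧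
    ∃ φ : HO (W.functorCategory L) ⟶ (HO W).shift L,
      (∀ (I : Type w) [SmallCategory I],
        (HO.Q (W.functorCategory L) I ⋙ Prederivator.StrictHom.app φ I :
            (I ⥤ L ⥤ M) ⥤ (HO W).obj (L × I)) =
          expLaw L I M ⋙ HO.Q W (L × I)) ∧
      IsIso φ ∧
      Prederivator.IsStrongEquivalence φ :=
  ⟨hW.functorCategory L, hW.isDerivator.shift L, HO.exp W L, fun I _ => Q_comp_hoExp W L I,
    inferInstance, Prederivator.isStrongEquivalence_of_isIso _⟩
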